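/- Let $N\ge 1$ be an integer, $s\in(0,1)$, $T>0$ and $S_T:=\mathbb R^N\times(0,T]$. Let $\mathcal L^s(\mathbb R^N)$ be the space of measurable $f:\mathbb R^N\to\mathbb R$ with $\|f\|_{1,s}:=\int_{\mathbb R^N}\frac{|f(x)|}{1+|x|^{N+2s}}\,dx<\infty$, and write $$(-\Delta)^s f(x)=C_{N,s}\lim_{\varepsilon\to0^+}\int_{\{|x-y|\ge\varepsilon\}}\frac{f(x)-f(y)}{|x-y|^{N+2s}}\,dy,\qquad C_{N,s}=\frac{2^{2s-1}\,2s\,\Gamma\left(\frac{N+2s}{2}\right)}{\pi^{N/2}\,\Gamma(1-s)},$$ whenever this limit exists and is finite. Assume $(H_0)$: $\rho\in C(\mathbb R^N)$ and there are $\alpha\ge0$ and $C_0>0$ such that $\rho(x)\ge C_0(1+|x|^2)^{-\alpha/2}$ for all $x\in\mathbb R^N$; and suppose that $\alpha<2s$. Let $u$ be a solution of the Cauchy problem $$\rho\,u_t-\Delta u+(-\Delta)^s u=0\ \text{ in } S_T,\qquad u=0\ \text{ in }\mathbb R^N\times\{0\},$$ in the following sense: $u\in C^2(\mathbb R^N\times[0,T])$;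 $u\in L^1\big((0,T),\mathcal L^s(\mathbb R^N)\big)$; $u(\cdot,t)\in\mathcal L^s(\mathbb R^N)$ for each $t\in(0,T]$; for every $(x,t)\in S_T$ the limit defining $(-\Delta)^s u(\cdot,t)(x)$ exists and is finite and the equation holds at $(x,t)$ (with the one-sided time derivative at $t=T$); and $u(x,0)=0$ for all $x\in\mathbb R^N$. If $$|u(x,t)|\le C(1+|x|^2)^{\theta/2}\quad\text{for all }(x,t)\in S_T$$ for some $C>0$ and some $0\le\theta<2s-\alpha$, then $u\equiv0$ in $S_T$. -/

import Mathlib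

open MeasureTheory Filter Topology Set

noncomputable section

/-- The weighted seminorm `∫ |f(x)| / (1 + |x|^(N+2s)) dx`, with values in `[0, ∞]`. -/
def lsNorm {N : ℕ} (s : ℝ) (f : EuclideanSpace ℝ (Fin N) → ℝ) : ENNReal :=
  ∫⁻ x, ENNReal.ofReal (|f x| / (1 + ‖x‖ ^ ((N : ℝ) + 2 * s)))

/-- The space `𝓛^s(ℝ^N)` of (measurable) functions with finite weighted integral. -/
def MemLs {N : ℕ} (s : ℝ) (f : EuclideanSpace ℝ (Fin N) → ℝ) : Prop :=
  AEStronglyMeasurable f volume ∧ lsNorm s f < ⊤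

/-- The normalization constant
`C_{N,s} = 2^(2s-1) · 2s · Γ((N+2s)/2) / (π^(N/2) · Γ(1-s))`. -/
def fracLapConst (N : ℕ) (s : ℝ) : ℝ :=
  (2 : ℝ) ^ (2 * s - 1) * (2 * s) * Real.Gamma (((N : ℝ) + 2 * s) / 2) /
    (Real.pi ^ ((N : ℝ) / 2) * Real.Gamma (1 - s))

/-- The truncated singular integral
`C_{N,s} ∫_{|x-y| ≥ ε} (f(x) - f(y)) / |x-y|^(N+2s) dy`. For `ε > 0` and `f ∈ 𝓛^s(ℝ^N)`
the integrand is integrable. -/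
def fracLapTrunc {N : ℕ} (s : ℝ) (f : EuclideanSpace ℝ (Fin N) → ℝ)
    (x : EuclideanSpace ℝ (Fin N)) (ε : ℝ) : ℝ :=
  fracLapConst N s *
    ∫ y in {y | ε ≤ ‖x - y‖}, (f x - f y) / ‖x - y‖ ^ ((N : ℝ) + 2 * s)

/-- `(-Δ)^s f (x)` exists as a principal value and equals `L`. -/
def HasFracLaplacianAt {N : ℕ} (s : ℝ) (f : EuclideanSpace ℝ (Fin N) → ℝ) (L : ℝ)
    (x : EuclideanSpace ℝ (Fin N)) : Prop :=
  Tendsto (fun ε : ℝ => fracLapTrunc s f x ε) (𝓝[>] 0) (𝓝 L)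

/-- Assumption `(H₀)` on the coefficient `ρ`, with exponent `α`. -/
structure AssumptionH0 {N : ℕ} (ρ : EuclideanSpace ℝ (Fin N) → ℝ) (α : ℝ) : Prop where
  continuous : Continuous ρ
  alpha_nonneg : 0 ≤ α
  lower_bound : ∃ C₀ : ℝ, 0 < C₀ ∧ ∀ x, C₀ * (1 + ‖x‖ ^ 2) ^ (-(α / 2)) ≤ ρ x

/-- `u` (with `u x t` the value at the point `x` and the time `t`) is a solution of
`ρ u_t - Δu + (-Δ)^s u = 0` in `S_T = ℝ^N × (0, T]`. The derivatives at `t = T` are one-sided. -/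
structure IsSolutionEquation {N : ℕ} (s T : ℝ) (ρ : EuclideanSpace ℝ (Fin N) → ℝ)
    (u : EuclideanSpace ℝ (Fin N) → ℝ → ℝ) : Prop where
  contDiffOn : ContDiffOn ℝ 2 (Function.uncurry u) (univ ×ˢ Ioc 0 T)
  memLs : ∀ t ∈ Ioc 0 T, MemLs s (fun y => u y t)
  equation : ∀ x, ∀ t ∈ Ioc 0 T, ∃ L : ℝ, HasFracLaplacianAt s (fun y => u y t) L x ∧
    ρ x * derivWithin (u x) (Ioc 0 T) t - Laplacian.laplacian (fun y => u y t) x + L = 0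

/-- `u` is a solution of the Cauchy problem for `ρ u_t - Δu + (-Δ)^s u = 0` in `S_T` with zero
initial data. The first two fields say `u ∈ C²(ℝ^N × [0, T])` (so that `u` is jointly measurable
there) and `u ∈ L¹((0, T); 𝓛^s(ℝ^N))`. -/
structure IsSolutionCauchyProblem {N : ℕ} (s T : ℝ) (ρ : EuclideanSpace ℝ (Fin N) → ℝ)
    (u : EuclideanSpace ℝ (Fin N) → ℝ → ℝ) : Prop where
  contDiffOn_closure : ContDiffOn ℝ 2 (Function.uncurry u) (univ ×ˢ Icc 0 T)
  integrable_time : ∫⁻ t in Ioo 0 T, lsNorm s (fun y => u y t) < ⊤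
  solution : IsSolutionEquation s T ρ u
  initial : ∀ x, u x 0 = 0

end

/-! Compare `u` with the barrier ε e^{λt} Ψ, where Ψ = (1+|x|²)^p and max(θ/2, α/2) < p < s. As p >
θ/2, the barrier outgrows `u`, so a positive value of the difference forces a positive maximum over
ℝ^N × [0,T], attained at some (x₀, t₀) with t₀ > 0. There the second differences of `u` are at most
those of the barrier, hence at most 2η min(|z|², |z|^{2p}) with η = ε e^{λt₀}. This kernel is
integrable against |z|^{-N-2s} because p < s < 1, so -Δu and (-Δ)^s u are bounded below by constant
multiples of -η. On the other side p > α/2 gives ρΨ ≥ C₀, hence ρ u_t ≥ λC₀η, and a large λ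
contradicts the equation. Since ε is arbitrary, u ≤ 0; the same applies to -u. -/

/-- Second differences of `(1 + |x|²)^p` with `0 ≤ p ≤ 1`. -/
lemma one_add_norm_sq_rpow_second_difference_le {E : Type*} [NormedAddCommGroup E]
    [InnerProductSpace ℝ E] {p : ℝ} (hp₀ : 0 ≤ p) (hp₁ : p ≤ 1) (x z : E) :
    (1 + ‖x + z‖ ^ 2) ^ p + (1 + ‖x - z‖ ^ 2) ^ p - 2 * (1 + ‖x‖ ^ 2) ^ p
      ≤ 2 * min (‖z‖ ^ (2 : ℝ)) (‖z‖ ^ (2 * p)) := by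
  have hadd := norm_add_sq_real x z
  have hsub := norm_sub_sq_real x z
  set a := 1 + ‖x‖ ^ 2 with ha
  have ha₁ : 1 ≤ a := by rw [ha]; nlinarith [sq_nonneg ‖x‖]
  set b := ‖z‖ ^ 2 with hb
  have hb₀ : 0 ≤ b := sq_nonneg _
  -- By the parallelogram law the two arguments average to `a + b`; concavity of the power does the
  -- rest.
  have hmid : (1 + ‖x + z‖ ^ 2) ^ p + (1 + ‖x - z‖ ^ 2) ^ p ≤ 2 * (a + b) ^ p := by
    have h := (Real.concaveOn_rpow hp₀ hp₁).2
      (show 1 + ‖x + z‖ ^ 2 ∈ Ici (0 : ℝ) by simp only [mem_Ici]; positivity)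
      (show 1 + ‖x - z‖ ^ 2 ∈ Ici (0 : ℝ) by simp only [mem_Ici]; positivity)
      (show (0 : ℝ) ≤ 1 / 2 by norm_num) (show (0 : ℝ) ≤ 1 / 2 by norm_num) (by norm_num)
    simp only [smul_eq_mul] at h
    have e : 1 / 2 * (1 + ‖x + z‖ ^ 2) + 1 / 2 * (1 + ‖x - z‖ ^ 2) = a + b := by
      rw [hadd, hsub, ha]; ring
    rw [e] at h
    linarith
  have hfar : (a + b) ^ p ≤ a ^ p + ‖z‖ ^ (2 * p) := by
    have := Real.rpow_add_le_add_rpow (by linarith : 0 ≤ a) hb₀ hp₀ hp₁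
    rwa [hb, ← Real.rpow_two, ← Real.rpow_mul (norm_nonneg z), Real.rpow_two, ← hb] at this
  -- Bernoulli's inequality; `1 ≤ a` makes the bound uniform in `x`.
  have hnear : (a + b) ^ p ≤ a ^ p + ‖z‖ ^ (2 : ℝ) := by
    have e : a + b = a * (1 + b / a) := by field_simp
    have h1 : (1 + b / a) ^ p ≤ 1 + p * (b / a) :=
      rpow_one_add_le_one_add_mul_self (by have : 0 ≤ b / a := by positivity
                                           linarith) hp₀ hp₁
    have h2 : a ^ p ≤ a := by
      simpa using Real.rpow_le_rpow_of_exponent_le ha₁ hp₁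
    have h3 : (1 + b / a) ^ p ≤ 1 + b / a :=
      h1.trans (by nlinarith [show 0 ≤ b / a by positivity])
    rw [e, Real.mul_rpow (by linarith) (by positivity), Real.rpow_two, ← hb]
    calc a ^ p * (1 + b / a) ^ p ≤ a ^ p * (1 + b / a) := by gcongr
      _ = a ^ p + a ^ p * (b / a) := by ring
      _ ≤ a ^ p + a * (b / a) := by gcongr
      _ = a ^ p + b := by field_simp
  rcases min_choice (‖z‖ ^ (2 : ℝ)) (‖z‖ ^ (2 * p)) with h | h <;> rw [h] <;> linarith

/-- In polar coordinates the integrand is min(r^{a-σ-1}, r^{b-σ-1}): the first power is integrable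
on (0,1], the second on (1,∞). -/
lemma integrable_min_rpow_norm_div {E : Type*} [NormedAddCommGroup E] [NormedSpace ℝ E]
    [FiniteDimensional ℝ E] [MeasurableSpace E] [BorelSpace E] [Nontrivial E]
    (μ : Measure E) [μ.IsAddHaarMeasure] {a b σ : ℝ} (ha : σ < a) (hb : b < σ) :
    Integrable (fun z : E => min (‖z‖ ^ a) (‖z‖ ^ b) /
      ‖z‖ ^ ((Module.finrank ℝ E : ℝ) + σ)) μ := by
  have hd : 1 ≤ Module.finrank ℝ E := Module.finrank_pos
  rw [integrable_fun_norm_addHaar μ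
    (f := fun r : ℝ => min (r ^ a) (r ^ b) / r ^ ((Module.finrank ℝ E : ℝ) + σ))]
  set d := Module.finrank ℝ E
  have key : ∀ r : ℝ, 0 < r → r ^ (d - 1) • (min (r ^ a) (r ^ b) / r ^ ((d : ℝ) + σ))
      = min (r ^ (a - σ - 1)) (r ^ (b - σ - 1)) := by
    intro r hr
    have e : ∀ q : ℝ, r ^ (q - σ - 1) = r ^ q * (r ^ (d - 1) / r ^ ((d : ℝ) + σ)) := by
      intro q
      rw [← Real.rpow_natCast r (d - 1), ← Real.rpow_sub hr, ← Real.rpow_add hr]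
      congr 1
      push_cast [hd]
      ring
    rw [e, e, ← min_mul_of_nonneg _ _ (by positivity), smul_eq_mul]
    ring
  rw [integrableOn_congr_fun (s := Ioi 0) (fun r hr => key r hr) measurableSet_Ioi,
    ← Ioc_union_Ioi_eq_Ioi zero_le_one, integrableOn_union]
  have hmeas : Measurable fun r : ℝ => min (r ^ (a - σ - 1)) (r ^ (b - σ - 1)) := by
    fun_prop
  constructor
  · have : IntegrableOn (fun r : ℝ => r ^ (a - σ - 1)) (Ioc 0 1) :=
      (intervalIntegrable_iff_integrableOn_Ioc_of_le zero_le_one).1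
        (intervalIntegral.intervalIntegrable_rpow' (by linarith))
    refine this.mono' hmeas.aestronglyMeasurable
      (ae_restrict_of_forall_mem measurableSet_Ioc fun r hr => ?_)
    have hr0 : (0 : ℝ) < r := hr.1
    rw [Real.norm_of_nonneg (by positivity)]
    exact min_le_left _ _
  · refine (integrableOn_Ioi_rpow_of_lt (a := b - σ - 1) (by linarith) one_pos).mono'
      hmeas.aestronglyMeasurable (ae_restrict_of_forall_mem measurableSet_Ioi fun r hr => ?_)
    have hr0 : (0 : ℝ) < r := one_pos.trans hr
    rw [Real.norm_of_nonneg (by positivity)]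
    exact min_le_right _ _

/-! ### Local and fractional Laplacians controlled by second differences -/

/-- `G` has a global maximum at 0. Were `G''(0) > 0`, then 0 would also be a local minimum, so `G`
would be locally constant and `G''(0) = 0`. -/
lemma deriv_deriv_le_of_second_difference_le {φ : ℝ → ℝ} (hφ : ContDiff ℝ 2 φ) {c : ℝ}
    (h : ∀ r, φ r + φ (-r) - 2 * φ 0 ≤ 2 * c * r ^ 2) : deriv (deriv φ) 0 ≤ 2 * c := by
  have hφ₁ : Differentiable ℝ φ := hφ.differentiable (by norm_num)
  have hφ₂ : Differentiable ℝ (deriv φ) :=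
    (hφ.iterate_deriv' 1 1).differentiable (by norm_num)
  set G : ℝ → ℝ := fun r => φ r + φ (-r) - 2 * c * r ^ 2
  have hG : ∀ r, HasDerivAt G (deriv φ r - deriv φ (-r) - 4 * c * r) r := by
    intro r
    have h1 := (hφ₁ r).hasDerivAt
    have h2 := (hφ₁ (-r)).hasDerivAt.comp r (hasDerivAt_neg r)
    have h3 := ((hasDerivAt_id r).pow 2).const_mul (2 * c)
    refine ((h1.add h2).sub h3).congr_deriv ?_
    simp
    ring
  have hG' : deriv G = fun r => deriv φ r - deriv φ (-r) - 4 * c * r :=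
    funext fun r => (hG r).deriv
  have hG₂ : HasDerivAt (deriv G) (2 * deriv (deriv φ) 0 - 4 * c) 0 := by
    rw [hG']
    have h1 := (hφ₂ 0).hasDerivAt
    have h2 := (hφ₂ (-0)).hasDerivAt.comp 0 (hasDerivAt_neg (0 : ℝ))
    have h3 := (hasDerivAt_id (0 : ℝ)).const_mul (4 * c)
    refine ((h1.sub h2).sub h3).congr_deriv ?_
    simp
    ring
  by_contra! hlt
  have hmin : IsLocalMin G 0 := isLocalMin_of_deriv_deriv_pos
    (by rw [hG₂.deriv]; linarith) (by rw [hG']; simp) (hG 0).continuousAt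
  have hmax : ∀ r, G r ≤ G 0 := fun r => by
    have := h r
    simp only [G]
    simp
    linarith
  have hconst : G =ᶠ[𝓝 0] fun _ => G 0 := hmin.mono fun r hr => le_antisymm (hmax r) hr
  have h0 : deriv (deriv G) 0 = 0 := by
    rw [hconst.deriv.deriv_eq]
    simp
  rw [hG₂.deriv] at h0
  linarith

lemma iteratedFDeriv_two_apply_self_eq_deriv_deriv {E : Type*} [NormedAddCommGroup E]
    [NormedSpace ℝ E] {f : E → ℝ} (hf : ContDiff ℝ 2 f) (x v : E) :
    iteratedFDeriv ℝ 2 f x ![v, v] = deriv (deriv fun r : ℝ => f (x + r • v)) 0 := by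
  have hline : ∀ r : ℝ, HasDerivAt (fun r : ℝ => x + r • v) v r := fun r => by
    simpa using ((hasDerivAt_id r).smul_const v).const_add x
  have h1 : (deriv fun r : ℝ => f (x + r • v)) = fun r => fderiv ℝ f (x + r • v) v := by
    funext r
    exact ((hf.differentiable (by norm_num) _).hasFDerivAt.comp_hasDerivAt r (hline r)).deriv
  have hf₂ : Differentiable ℝ (fderiv ℝ f) :=
    (hf.fderiv_right (m := 1) (by norm_num)).differentiable (by norm_num)
  have h2 : HasDerivAt (fun r : ℝ => fderiv ℝ f (x + r • v) v)
      (fderiv ℝ (fderiv ℝ f) (x + (0 : ℝ) • v) v v) 0 := by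
    have := (hf₂ (x + (0 : ℝ) • v)).hasFDerivAt.comp_hasDerivAt (0 : ℝ) (hline 0)
    exact this.clm_apply (hasDerivAt_const _ v) |>.congr_deriv (by simp)
  rw [h1, h2.deriv, iteratedFDeriv_two_apply]
  simp

lemma laplacian_le_of_second_difference_le {N : ℕ} {f : EuclideanSpace ℝ (Fin N) → ℝ}
    (hf : ContDiff ℝ 2 f) {c : ℝ} {x : EuclideanSpace ℝ (Fin N)}
    (h : ∀ z, f (x + z) + f (x - z) - 2 * f x ≤ 2 * c * ‖z‖ ^ 2) :
    Laplacian.laplacian f x ≤ 2 * N * c := by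
  rw [InnerProductSpace.laplacian_eq_iteratedFDeriv_orthonormalBasis f
    (EuclideanSpace.basisFun (Fin N) ℝ)]
  calc _ ≤ ∑ _i : Fin N, 2 * c := by
        refine Finset.sum_le_sum fun i _ => ?_
        rw [iteratedFDeriv_two_apply_self_eq_deriv_deriv hf]
        refine deriv_deriv_le_of_second_difference_le (by fun_prop) fun r => ?_
        have := h (r • EuclideanSpace.basisFun (Fin N) ℝ i)
        rw [norm_smul, (EuclideanSpace.basisFun (Fin N) ℝ).norm_eq_one] at this
        simpa [sub_eq_add_neg] using this
    _ = 2 * N * c := by simp; ring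

lemma fracLapConst_nonneg (N : ℕ) {s : ℝ} (hs₀ : 0 < s) (hs₁ : s < 1) :
    0 ≤ fracLapConst N s := by
  have h1 : 0 < Real.Gamma (((N : ℝ) + 2 * s) / 2) := Real.Gamma_pos_of_pos (by positivity)
  have h2 : 0 < Real.Gamma (1 - s) := Real.Gamma_pos_of_pos (by linarith)
  unfold fracLapConst
  positivity

/-- A bound on second differences by an integrable kernel bounds the fractional Laplacian. -/
lemma HasFracLaplacianAt.ge_of_second_difference_le {N : ℕ} {s : ℝ} (hs₀ : 0 < s) (hs₁ : s < 1)
    {f : EuclideanSpace ℝ (Fin N) → ℝ} {L : ℝ} {x : EuclideanSpace ℝ (Fin N)}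
    (hL : HasFracLaplacianAt s f L x) {m : EuclideanSpace ℝ (Fin N) → ℝ} (hm₀ : ∀ z, 0 ≤ m z)
    (hm : Integrable fun z => m z / ‖z‖ ^ ((N : ℝ) + 2 * s))
    (h : ∀ z, f (x + z) + f (x - z) - 2 * f x ≤ 2 * m z) :
    -(fracLapConst N s * ∫ z, m z / ‖z‖ ^ ((N : ℝ) + 2 * s)) ≤ L := by
  set k := (N : ℝ) + 2 * s
  have hI₀ : 0 ≤ ∫ z, m z / ‖z‖ ^ k := integral_nonneg fun z => by
    have := hm₀ z
    simp only [Pi.zero_apply]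
    positivity
  refine ge_of_tendsto hL (Eventually.of_forall fun ε => ?_)
  unfold fracLapTrunc
  rw [← mul_neg]
  refine mul_le_mul_of_nonneg_left ?_ (fracLapConst_nonneg N hs₀ hs₁)
  have hA : MeasurableSet {z : EuclideanSpace ℝ (Fin N) | ε ≤ ‖z‖} :=
    measurableSet_le measurable_const measurable_norm
  have hA' : MeasurableSet {y : EuclideanSpace ℝ (Fin N) | ε ≤ ‖x - y‖} :=
    measurableSet_le measurable_const (by fun_prop)
  set F : EuclideanSpace ℝ (Fin N) → ℝ :=
    {z | ε ≤ ‖z‖}.indicator fun z => (f x - f (x - z)) / ‖z‖ ^ k with hF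
  have hshift : ∫ y in {y | ε ≤ ‖x - y‖}, (f x - f y) / ‖x - y‖ ^ k = ∫ z, F z := by
    rw [← integral_indicator hA', ← integral_sub_left_eq_self F volume x]
    congr 1
    funext y
    simp only [hF, indicator, mem_ofPred_eq, sub_sub_cancel]
  rw [hshift]
  -- Without integrability the integral is 0 by convention and the bound is trivial.
  by_cases hFi : Integrable F
  swap
  · rw [integral_undef hFi]
    linarith
  -- Symmetrizing under z ↦ -z turns first differences into second differences.
  have hsum : ∫ z, -(2 * (m z / ‖z‖ ^ k)) ≤ ∫ z, (F z + F (-z)) := by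
    refine integral_mono (hm.const_mul 2).neg (hFi.add hFi.comp_neg) fun z => ?_
    have hmz := hm₀ z
    by_cases hz : ε ≤ ‖z‖
    · simp only [hF, indicator, mem_ofPred_eq, norm_neg, hz, if_true, sub_neg_eq_add]
      rw [← add_div, ← mul_div_assoc, ← neg_div]
      have := h z
      gcongr
      linarith
    · simp only [hF, indicator, mem_ofPred_eq, norm_neg, hz, if_false]
      have : 0 ≤ m z / ‖z‖ ^ k := by positivity
      linarith
  rw [integral_add hFi hFi.comp_neg, integral_neg_eq_self F volume, integral_neg,
    integral_const_mul] at hsum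
  linarith

lemma HasFracLaplacianAt.neg {N : ℕ} {s : ℝ} {f : EuclideanSpace ℝ (Fin N) → ℝ} {L : ℝ}
    {x : EuclideanSpace ℝ (Fin N)} (h : HasFracLaplacianAt s f L x) :
    HasFracLaplacianAt s (fun y => -f y) (-L) x := by
  unfold HasFracLaplacianAt at h ⊢
  refine h.neg.congr fun ε => ?_
  unfold fracLapTrunc
  rw [← mul_neg, ← integral_neg]
  congr 2
  funext y
  ring

lemma IsSolutionCauchyProblem.neg {N : ℕ} {s T : ℝ} {ρ : EuclideanSpace ℝ (Fin N) → ℝ}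
    {u : EuclideanSpace ℝ (Fin N) → ℝ → ℝ} (hu : IsSolutionCauchyProblem s T ρ u) :
    IsSolutionCauchyProblem s T ρ (fun x t => -u x t) where
  contDiffOn_closure := hu.contDiffOn_closure.neg
  integrable_time := by simpa [lsNorm] using hu.integrable_time
  solution :=
    { contDiffOn := hu.solution.contDiffOn.neg
      memLs := fun t ht => ⟨(hu.solution.memLs t ht).1.neg, by
        simpa [lsNorm] using (hu.solution.memLs t ht).2⟩
      equation := fun x t ht => by
        obtain ⟨L, hL, h⟩ := hu.solution.equation x t ht
        refine ⟨-L, hL.neg, ?_⟩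
        have h1 : derivWithin (fun t => -u x t) (Ioc 0 T) t = -derivWithin (u x) (Ioc 0 T) t :=
          derivWithin.fun_neg
        have h2 : Laplacian.laplacian (fun y => -u y t) x =
            -Laplacian.laplacian (fun y => u y t) x :=
          congrFun (InnerProductSpace.laplacian_neg (f := fun y => u y t)) x
        rw [h1, h2]
        linarith }
  initial := fun x => by simp [hu.initial x]

/-! ### The comparison argument -/

/-- Only left difference quotients enter, so a maximum at the final time `t = T` is covered. -/
lemma HasDerivWithinAt.le_of_sub_le_sub_left {φ ψ : ℝ → ℝ} {a b : ℝ} {t T : ℝ}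
    (ht : t ∈ Ioc 0 T) (hφ : HasDerivWithinAt φ a (Ioc 0 T) t) (hψ : HasDerivAt ψ b t)
    (h : ∀ r ∈ Ioo 0 t, φ r - ψ r ≤ φ t - ψ t) : b ≤ a := by
  have hd : HasDerivWithinAt (fun r => φ r - ψ r) (a - b) (Ioo 0 t) t :=
    (hφ.mono fun r hr => ⟨hr.1, hr.2.le.trans ht.2⟩).sub hψ.hasDerivWithinAt
  rw [hasDerivWithinAt_iff_tendsto_slope' (by simp)] at hd
  have : (𝓝[Ioo 0 t] t).NeBot := by
    rw [nhdsWithin_Ioo_eq_nhdsLT ht.1]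
    infer_instance
  have h0 : 0 ≤ a - b := by
    refine ge_of_tendsto hd (eventually_mem_nhdsWithin.mono fun r hr => ?_)
    rw [slope_def_field]
    exact div_nonneg_of_nonpos (by linarith [h r hr]) (by linarith [hr.2])
  linarith

lemma exists_forall_lt_rpow_one_add_norm_sq {E : Type*} [NormedAddCommGroup E] {q p C ε : ℝ}
    (hqp : q < p) (hε : 0 < ε) :
    ∃ R : ℝ, 0 < R ∧ ∀ x : E, R < ‖x‖ → C * (1 + ‖x‖ ^ 2) ^ q < ε * (1 + ‖x‖ ^ 2) ^ p := by
  have h := (tendsto_rpow_atTop (sub_pos.2 hqp)).eventually_gt_atTop (C / ε)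
  obtain ⟨A, hA⟩ := eventually_atTop.1 h
  refine ⟨max 1 A, by positivity, fun x hx => ?_⟩
  have h1 : 1 < ‖x‖ := (le_max_left _ _).trans_lt hx
  have h2 : A < ‖x‖ := (le_max_right _ _).trans_lt hx
  have h3 := hA (1 + ‖x‖ ^ 2) (by nlinarith)
  rw [div_lt_iff₀ hε] at h3
  have h4 : (1 + ‖x‖ ^ 2) ^ p = (1 + ‖x‖ ^ 2) ^ (p - q) * (1 + ‖x‖ ^ 2) ^ q := by
    rw [← Real.rpow_add (by positivity)]
    ring_nf
  rw [h4, ← mul_assoc]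
  gcongr
  linarith

/-- Maximum principle: a solution growing more slowly than the barrier is nonpositive. -/
lemma IsSolutionCauchyProblem.nonpos {N : ℕ} (hN : 1 ≤ N) {s : ℝ} (hs₀ : 0 < s) (hs₁ : s < 1)
    {T : ℝ} {α : ℝ} {ρ : EuclideanSpace ℝ (Fin N) → ℝ}
    (hρ : AssumptionH0 ρ α) (hα : α < 2 * s)
    {u : EuclideanSpace ℝ (Fin N) → ℝ → ℝ} (hu : IsSolutionCauchyProblem s T ρ u)
    {C θ : ℝ} (hθ : θ < 2 * s)
    (hgrowth : ∀ x, ∀ t ∈ Set.Ioc 0 T, u x t ≤ C * (1 + ‖x‖ ^ 2) ^ (θ / 2))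
    (x : EuclideanSpace ℝ (Fin N)) {t : ℝ} (ht : t ∈ Set.Ioc 0 T) : u x t ≤ 0 := by
  obtain ⟨C₀, hC₀, hρC₀⟩ := hρ.lower_bound
  have hα₀ := hρ.alpha_nonneg
  obtain ⟨p, hpmax, hps⟩ : ∃ p, max (θ / 2) (α / 2) < p ∧ p < s :=
    exists_between (max_lt (by linarith) (by linarith))
  have hθp : θ / 2 < p := (le_max_left _ _).trans_lt hpmax
  have hαp : α / 2 < p := (le_max_right _ _).trans_lt hpmax
  have hp₀ : 0 < p := by linarith
  have : Nonempty (Fin N) := ⟨⟨0, hN⟩⟩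
  have hmI : Integrable fun z : EuclideanSpace ℝ (Fin N) =>
      min (‖z‖ ^ (2 : ℝ)) (‖z‖ ^ (2 * p)) / ‖z‖ ^ ((N : ℝ) + 2 * s) := by
    simpa using integrable_min_rpow_norm_div (E := EuclideanSpace ℝ (Fin N)) volume
      (a := 2) (b := 2 * p) (σ := 2 * s) (by linarith) (by linarith)
  set K := fracLapConst N s * ∫ z : EuclideanSpace ℝ (Fin N),
      min (‖z‖ ^ (2 : ℝ)) (‖z‖ ^ (2 * p)) / ‖z‖ ^ ((N : ℝ) + 2 * s) with hK
  have hK₀ : 0 ≤ K := mul_nonneg (fracLapConst_nonneg N hs₀ hs₁)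
    (integral_nonneg fun z => by simp only [Pi.zero_apply]; positivity)
  -- 2N bounds the Laplacian term and K the fractional one, per unit of η; the extra 1 makes the
  -- contradiction strict.
  set lam := (2 * N + K + 1) / C₀ with hlam
  have hlam₀ : 0 < lam := by positivity
  set Ψ : EuclideanSpace ℝ (Fin N) → ℝ := fun x => (1 + ‖x‖ ^ 2) ^ p with hΨ
  have hΨ₀ : ∀ x, 0 < Ψ x := fun x => by simp only [hΨ]; positivity
  have key : ∀ ε : ℝ, 0 < ε → u x t - ε * (Real.exp (lam * t) * Ψ x) ≤ 0 := by
    intro ε hε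
    by_contra! hpos
    set w : EuclideanSpace ℝ (Fin N) × ℝ → ℝ :=
      fun q => u q.1 q.2 - ε * (Real.exp (lam * q.2) * Ψ q.1) with hw
    have hwc : ContinuousOn w (univ ×ˢ Icc 0 T) := by
      refine hu.contDiffOn_closure.continuousOn.sub (Continuous.continuousOn ?_)
      refine continuous_const.mul (.mul (by fun_prop) ?_)
      exact Continuous.rpow_const (by fun_prop) fun q => Or.inr hp₀.le
    obtain ⟨R, hR₀, hR⟩ := exists_forall_lt_rpow_one_add_norm_sq
      (E := EuclideanSpace ℝ (Fin N)) (C := C) hθp hε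
    have hout : ∀ y, ∀ r ∈ Icc 0 T, R < ‖y‖ ∨ r = 0 → w (y, r) < 0 := by
      intro y r hr hyr
      have hexp : 1 ≤ Real.exp (lam * r) := Real.one_le_exp (mul_nonneg hlam₀.le hr.1)
      have hΨy := hΨ₀ y
      rcases hr.1.eq_or_lt with h0 | h0
      · simp only [hw, ← h0, hu.initial]
        have : 0 < ε * (Real.exp (lam * 0) * Ψ y) := by positivity
        linarith
      · have h1 := hgrowth y r ⟨h0, hr.2⟩
        have h2 := hR y (hyr.resolve_right h0.ne')
        have h3 : ε * (1 * Ψ y) ≤ ε * (Real.exp (lam * r) * Ψ y) := by gcongr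
        simp only [hw]
        simp only [hΨ] at h3 ⊢
        linarith
    have hxR : ‖x‖ ≤ R := by
      by_contra! h
      exact absurd (hout x t ⟨ht.1.le, ht.2⟩ (Or.inl h)) (not_lt.2 hpos.le)
    obtain ⟨⟨x₀, t₀⟩, hq, hmax⟩ := ((isCompact_closedBall (0 : EuclideanSpace ℝ (Fin N)) R).prod
      (isCompact_Icc (a := (0 : ℝ)) (b := T))).exists_isMaxOn
      ⟨(x, t), by simpa using hxR, ht.1.le, ht.2⟩
      (hwc.mono (prod_mono_left (subset_univ _)))
    have hw₀ : 0 < w (x₀, t₀) :=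
      hpos.trans_le (hmax (a := (x, t)) ⟨by simpa using hxR, ht.1.le, ht.2⟩)
    have hwmax : ∀ y, ∀ r ∈ Icc 0 T, w (y, r) ≤ w (x₀, t₀) := by
      intro y r hr
      by_cases hy : ‖y‖ ≤ R
      · exact hmax (a := (y, r)) ⟨by simpa using hy, hr⟩
      · exact (hout y r hr (Or.inl (not_le.1 hy))).le.trans hw₀.le
    have ht₀ : t₀ ∈ Ioc 0 T := by
      refine ⟨lt_of_le_of_ne hq.2.1 fun h => ?_, hq.2.2⟩
      exact absurd (hout x₀ t₀ hq.2 (Or.inr h.symm)) (not_lt.2 hw₀.le)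
    set η := ε * Real.exp (lam * t₀) with hη
    have hη₀ : 0 < η := by positivity
    -- At a spatial maximum of `w`, second differences of `u` are dominated by those of the barrier.
    have hspace : ∀ z, u (x₀ + z) t₀ + u (x₀ - z) t₀ - 2 * u x₀ t₀ ≤
        2 * (η * min (‖z‖ ^ (2 : ℝ)) (‖z‖ ^ (2 * p))) := by
      intro z
      have h1 := hwmax (x₀ + z) t₀ hq.2
      have h2 := hwmax (x₀ - z) t₀ hq.2
      have h3 := mul_le_mul_of_nonneg_left (one_add_norm_sq_rpow_second_difference_le
        hp₀.le (by linarith) x₀ z) hη₀.le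
      simp only [hw, hΨ, ← mul_assoc, ← hη] at h1 h2
      linarith
    obtain ⟨L, hL, heq⟩ := hu.solution.equation x₀ t₀ ht₀
    have hLge : -(η * K) ≤ L := by
      have := hL.ge_of_second_difference_le hs₀ hs₁
        (m := fun z => η * min (‖z‖ ^ (2 : ℝ)) (‖z‖ ^ (2 * p)))
        (fun z => by positivity)
        (by simpa only [mul_div_assoc] using hmI.const_mul η) hspace
      simp only [mul_div_assoc, integral_const_mul] at this
      rw [hK]
      linarith
    have hlap : Laplacian.laplacian (fun y => u y t₀) x₀ ≤ 2 * N * η := by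
      refine laplacian_le_of_second_difference_le ?_ fun z => (hspace z).trans ?_
      · rw [← contDiffOn_univ]
        exact hu.solution.contDiffOn.comp (f := fun y => (y, t₀)) (by fun_prop)
          fun y _ => ⟨mem_univ _, ht₀⟩
      · have := mul_le_mul_of_nonneg_left
          (min_le_left (‖z‖ ^ (2 : ℝ)) (‖z‖ ^ (2 * p))) hη₀.le
        rw [← Real.rpow_two]
        linarith
    have htime : η * lam * Ψ x₀ ≤ derivWithin (u x₀) (Ioc 0 T) t₀ := by
      have hdiff : DifferentiableWithinAt ℝ (u x₀) (Ioc 0 T) t₀ :=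
        ((hu.solution.contDiffOn.comp (f := fun r => (x₀, r)) (by fun_prop)
          fun r hr => ⟨mem_univ _, hr⟩ : ContDiffOn ℝ 2 _ (Ioc 0 T)).differentiableOn
            (by norm_num)) t₀ ht₀
      have hψ : HasDerivAt (fun r => ε * (Real.exp (lam * r) * Ψ x₀)) (η * lam * Ψ x₀) t₀ := by
        have := ((((hasDerivAt_id t₀).const_mul lam).exp).mul_const (Ψ x₀)).const_mul ε
        refine this.congr_deriv ?_
        simp only [hη, id]
        ring
      exact hdiff.hasDerivWithinAt.le_of_sub_le_sub_left ht₀ hψ fun r hr =>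
        hwmax x₀ r ⟨hr.1.le, hr.2.le.trans ht₀.2⟩
    have hρΨ : C₀ ≤ ρ x₀ * Ψ x₀ := by
      have h1 : (1 : ℝ) ≤ (1 + ‖x₀‖ ^ 2) ^ (-(α / 2)) * Ψ x₀ := by
        rw [hΨ, ← Real.rpow_add (by positivity)]
        exact Real.one_le_rpow (by nlinarith [sq_nonneg ‖x₀‖]) (by linarith)
      calc C₀ = C₀ * 1 := (mul_one _).symm
        _ ≤ C₀ * ((1 + ‖x₀‖ ^ 2) ^ (-(α / 2)) * Ψ x₀) := by gcongr
        _ = C₀ * (1 + ‖x₀‖ ^ 2) ^ (-(α / 2)) * Ψ x₀ := by ring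
        _ ≤ ρ x₀ * Ψ x₀ := mul_le_mul_of_nonneg_right (hρC₀ x₀) (hΨ₀ x₀).le
    have hρ₀ : 0 ≤ ρ x₀ := le_trans (by positivity) (hρC₀ x₀)
    have h1 : η * (2 * N + K + 1) ≤ ρ x₀ * derivWithin (u x₀) (Ioc 0 T) t₀ :=
      calc η * (2 * N + K + 1) = η * lam * C₀ := by rw [hlam]; field_simp
        _ ≤ η * lam * (ρ x₀ * Ψ x₀) := by gcongr
        _ = ρ x₀ * (η * lam * Ψ x₀) := by ring
        _ ≤ _ := mul_le_mul_of_nonneg_left htime hρ₀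
    linarith
  by_contra! hux
  have hA : 0 < Real.exp (lam * t) * Ψ x := mul_pos (Real.exp_pos _) (hΨ₀ x)
  -- This ε makes the barrier equal to half of `u x t`.
  have := key (u x t / (2 * (Real.exp (lam * t) * Ψ x))) (by positivity)
  have e : u x t / (2 * (Real.exp (lam * t) * Ψ x)) * (Real.exp (lam * t) * Ψ x) = u x t / 2 := by
    rw [div_mul_eq_mul_div, mul_div_mul_right _ _ hA.ne']
  linarith

theorem corollary5p4 (N : ℕ) (hN : 1 ≤ N) (s : ℝ) (hs₀ : 0 < s) (hs₁ : s < 1)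
    (T : ℝ) (hT : 0 < T) (α : ℝ) (ρ : EuclideanSpace ℝ (Fin N) → ℝ)
    (hρ : AssumptionH0 ρ α) (hα : α < 2 * s)
    (u : EuclideanSpace ℝ (Fin N) → ℝ → ℝ) (hu : IsSolutionCauchyProblem s T ρ u)
    (C θ : ℝ) (hC : 0 < C) (hθ₀ : 0 ≤ θ) (hθ₁ : θ < 2 * s - α)
    (hgrowth : ∀ x, ∀ t ∈ Set.Ioc 0 T, |u x t| ≤ C * (1 + ‖x‖ ^ 2) ^ (θ / 2)) :
    ∀ x, ∀ t ∈ Set.Ioc 0 T, u x t = 0 := by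
  intro x t ht
  have hθ : θ < 2 * s := by linarith [hρ.alpha_nonneg]
  have h1 := hu.nonpos hN hs₀ hs₁ hρ hα hθ
    (fun y r hr => (le_abs_self _).trans (hgrowth y r hr)) x ht
  have h2 := hu.neg.nonpos hN hs₀ hs₁ hρ hα hθ
    (fun y r hr => (neg_le_abs _).trans (hgrowth y r hr)) x ht
  linarith
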